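/- Let $(R_n)_{n\in\omega}$ be a sequence of subsets of $\omega$ of strictly increasing Turing degree, and for each $n$ let $(R_n^i)_{i\in\omega}$ list all sets of naturals that differ from $R_n$ in only finitely many places. Let $M$ be the full Kripke model (of set theory) on the partial order $\omega^{<\omega}$ of finite sequences ordered by extension: a set of $M$ is a non-decreasing function from nodes to sets of sets of $M$. In $M$ let $R\subseteq\omega$ be given by $R(\langle\rangle)=\emptyset$ and $R(\sigma^\frown i)=R(\sigma)\cup\{\langle n,s\rangle : s\in R_n^i\}$ for $\sigma$ of length $n$. In $M$ let $\mathrm{App}$ be the applicative structure of indices of functions computable with oracle $R$ (a computation at a node converges only if each of its oracle queries $p$ is decided there, that is, $p\in R$ or $\neg\, p\in R$ is forced), and let $M[\mathrm{App}]$ be the realizability model of set theory over $\mathrm{App}$, built inside $M$; a set of $M[\mathrm{App}]$ is a set of pairs $\langle e,y\rangle$ with $e\in\mathrm{App}$ and $y$ a set of $M[\mathrm{App}]$. Write $\sigma\models_{App}\phi$ if at $\sigma$ it is true in $M$ that some $e$ realizes $\phi$. "$X$ is decidable" is the statement $\forall m\in\omega\,(m\in X\vee m\notin X)$. A set $Y\subseteq\omega$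 of the ambient universe is identified with the set $\check Y=\{\langle m,\bar m\rangle : m\in Y\}$ of $M[\mathrm{App}]$, where $\bar m$ is the $m$-th natural number of $M[\mathrm{App}]$. Let $\sigma$ be a node of length $n$, and put $R_{-1}=\emptyset$. Then: 1. For every $X\subseteq\omega$ in the ambient universe, $\sigma\models_{App}$ "$\check X$ is decidable" if and only if $X$ is Turing computable in $R_{n-1}$. 2. More generally, for every set $X$ of $M[\mathrm{App}]$ with $\sigma\models_{App} X\subseteq\omega$: $\sigma\models_{App}$ "$X$ is decidable" if and only if there is a $Y\subseteq\omega$ in the ambient universe, Turing computable in $R_{n-1}$, with $\sigma\models_{App} X=\check Y$. 3. If $\sigma\models_{App}$ "$X$ is an infinite branch through the binary tree" (finite binary sequences being coded by naturals: $X$ is a set of nodes, closed under initial segments, with exactly one element of each length), then $\sigma\models_{App}$ "$X$ is decidable". -/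

import Mathlib

universe u

noncomputable section

namespace KripkeReal

/-! ## The Kripke model `M` over `ω^{<ω}` -/

/-- The partial order of finite sequences of naturals; `σ ≤ τ` is `σ <+: τ`. -/
abbrev Node := List ℕ

/-- The sets of the full Kripke model `M`: a set is a non-decreasing function from nodes to sets
of sets of the model. `KSet.mk ι A P _` is the function `σ ↦ {A i | P i σ}`. -/
inductive KSet : Type (u + 1)
  | mk (ι : Type u) (A : ι → KSet) (P : ι → Node → Prop)
      (mono : ∀ i σ τ, σ <+: τ → P i σ → P i τ) : KSet

namespace KSet

/-- `σ ⊨ x = y`. -/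
def forcesEq : KSet.{u} → KSet.{u} → Node → Prop
  | mk _ A P _, mk _ B Q _, σ => ∀ τ, σ <+: τ →
      (∀ i, P i τ → ∃ j, Q j τ ∧ forcesEq (A i) (B j) τ) ∧
      (∀ j, Q j τ → ∃ i, P i τ ∧ forcesEq (A i) (B j) τ)

/-- `σ ⊨ x ∈ y`. -/
def forcesMem (x : KSet.{u}) : KSet.{u} → Node → Prop
  | mk _ B Q _, σ => ∃ j, Q j σ ∧ forcesEq x (B j) σ

/-- The canonical image `x̌` in `M` of a set `x` of the ground model `V`. -/
def check : PSet.{u} → KSet.{u}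
  | ⟨ι, A⟩ => mk ι (fun i => check (A i)) (fun _ _ => True) (fun _ _ _ _ _ => trivial)

end KSet

/-- `⟨k, s⟩ ∈ R(σ)`, where `F k i` is the `i`-th finite variation `R_k^i` of `R_k`:
the slice `k < |σ|` of `R(σ)` is `R_k^{σ(k)}`, and the other slices are empty. -/
def stage (F : ℕ → ℕ → Set ℕ) (σ : Node) : Set ℕ :=
  {p | ∃ i, σ[p.unpair.1]? = some i ∧ p.unpair.2 ∈ F p.unpair.1 i}

theorem stage_nil (F : ℕ → ℕ → Set ℕ) : stage F [] = ∅ := by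
  ext p; simp [stage]

theorem stage_append (F : ℕ → ℕ → Set ℕ) (σ : Node) (i : ℕ) :
    stage F (σ ++ [i]) = stage F σ ∪ {p | ∃ s ∈ F σ.length i, p = Nat.pair σ.length s} := by
  ext p
  simp only [stage, Set.mem_ofPred_eq, Set.mem_union]
  rcases lt_trichotomy p.unpair.1 σ.length with h | h | h
  · rw [List.getElem?_append_left h]
    refine ⟨Or.inl, ?_⟩
    rintro (h' | ⟨s, -, rfl⟩)
    · exact h'
    · simp at h
  · rw [h]
    simp only [List.getElem?_concat_length, Option.some.injEq, exists_eq_left']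
    constructor
    · intro hp
      exact Or.inr ⟨_, hp, by rw [← h, Nat.pair_unpair]⟩
    · rintro (⟨j, hj, -⟩ | ⟨s, hs, rfl⟩)
      · simp at hj
      · simpa using hs
  · have h1 : (σ ++ [i])[p.unpair.1]? = none := by simp; omega
    have h2 : σ[p.unpair.1]? = none := by simp; omega
    rw [h1, h2]
    simp only [reduceCtorEq, false_and, exists_false, false_or, false_iff, not_exists, not_and]
    rintro s - rfl
    simp at h

theorem stage_mono (F : ℕ → ℕ → Set ℕ) (p : ℕ) (σ τ : Node) (h : σ <+: τ)
    (hp : p ∈ stage F σ) : p ∈ stage F τ := by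
  obtain ⟨i, hi, hs⟩ := hp
  obtain ⟨ρ, rfl⟩ := h
  refine ⟨i, ?_, hs⟩
  rw [List.getElem?_append_left (List.getElem?_eq_some_iff.1 hi).1, hi]

/-- The special set `R` of natural numbers, as a set of `M`. -/
def specialR (F : ℕ → ℕ → Set ℕ) : KSet.{u} :=
  KSet.mk (ULift.{u} ℕ) (fun p => KSet.check (PSet.ofNat p.down))
    (fun p σ => p.down ∈ stage F σ) (fun p => stage_mono F p.down)

/-! ## Computation with oracle `R` inside `M` -/

open Classical in
/-- The oracle `R` at a node: a query `p` is answered by `1` if `σ ⊨ p ∈ R`, by `0` if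
`σ ⊨ ¬ (p ∈ R)`, and there is no answer otherwise. -/
def oracleAt (F : ℕ → ℕ → Set ℕ) (σ : Node) : ℕ →. ℕ := fun p =>
  if KSet.forcesMem (KSet.check (PSet.ofNat.{u} p)) (specialR.{u} F) σ then Part.some 1
  else if ∀ τ, σ <+: τ → ¬ KSet.forcesMem (KSet.check (PSet.ofNat.{u} p)) (specialR.{u} F) τ
    then Part.some 0
  else Part.none

/-- Programs for functions that are partial recursive in an oracle. -/
inductive OCode : Type
  | zero : OCode
  | succ : OCode
  | left : OCode
  | right : OCode
  | oracle : OCode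
  | pair : OCode → OCode → OCode
  | comp : OCode → OCode → OCode
  | prec : OCode → OCode → OCode
  | rfind : OCode → OCode

/-- The partial function computed by a program; a computation that asks the oracle a question
without an answer does not converge. -/
def OCode.eval (O : ℕ →. ℕ) : OCode → ℕ →. ℕ
  | .zero => fun _ => Part.some 0
  | .succ => fun n => Part.some (n + 1)
  | .left => fun n => Part.some n.unpair.1
  | .right => fun n => Part.some n.unpair.2
  | .oracle => O
  | .pair c d => fun n => Nat.pair <$> c.eval O n <*> d.eval O n
  | .comp c d => fun n => d.eval O n >>= c.eval O
  | .prec c d => fun p =>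
      Nat.rec (c.eval O p.unpair.1)
        (fun y IH => IH >>= fun i => d.eval O (Nat.pair p.unpair.1 (Nat.pair y i))) p.unpair.2
  | .rfind c => fun a => Nat.rfind fun n => (fun m => decide (m = 0)) <$> c.eval O (Nat.pair a n)

/-- The program with a given index; this is a bijection from `ℕ` to programs. -/
def OCode.ofIndex : ℕ → OCode
  | 0 => .zero
  | 1 => .succ
  | 2 => .left
  | 3 => .right
  | 4 => .oracle
  | n + 5 =>
    let m := n.div2.div2
    match n.bodd, n.div2.bodd with
    | false, false => .pair (ofIndex m.unpair.1) (ofIndex m.unpair.2)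
    | false, true => .comp (ofIndex m.unpair.1) (ofIndex m.unpair.2)
    | true, false => .prec (ofIndex m.unpair.1) (ofIndex m.unpair.2)
    | true, true => .rfind (ofIndex m)
decreasing_by
  all_goals
    have hm : n.div2.div2 < n + 5 := by simp only [Nat.div2_val]; omega
    first
      | exact hm
      | exact lt_of_le_of_lt (Nat.unpair_left_le _) hm
      | exact lt_of_le_of_lt (Nat.unpair_right_le _) hm

/-- The applicative structure `App` of `M`, at a node `σ`: `v ∈ app F σ e x` says
`σ ⊨ {e}^R(x) = v`. Its carrier is the set of all natural numbers. -/
def app (F : ℕ → ℕ → Set ℕ) (σ : Node) (e x : ℕ) : Part ℕ :=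
  (OCode.ofIndex e).eval (oracleAt.{u} F σ) x

/-! ## The realizability model `M[App]` -/

/-- The sets of `M[App]`. Within `M`, a set of `M[App]` is a set of pairs `⟨e, y⟩` with `e ∈ App`
and `y` a set of `M[App]`; so it is a non-decreasing function from nodes to sets of such pairs.
`RName.mk ι elt lab _` is the function `σ ↦ {⟨e, elt i⟩ | lab i e σ}`. -/
inductive RName : Type (u + 1)
  | mk (ι : Type u) (elt : ι → RName) (lab : ι → ℕ → Node → Prop)
      (mono : ∀ i e σ τ, σ <+: τ → lab i e σ → lab i e τ) : RName

namespace RName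

/-- The index type of a set of `M[App]`. -/
def Idx : RName.{u} → Type u
  | mk ι _ _ _ => ι

/-- The elements of a set of `M[App]`. -/
def elt : (x : RName.{u}) → x.Idx → RName.{u}
  | mk _ A _ _ => A

/-- `x.lab i e σ` says `σ ⊨ ⟨e, x.elt i⟩ ∈ x`. -/
def lab : (x : RName.{u}) → x.Idx → ℕ → Node → Prop
  | mk _ _ L _ => L

/-- The rank of a set of `M[App]`; it is used for recursions only. -/
def rank : RName.{u} → Ordinal.{u}
  | mk _ A _ _ => ⨆ i, Order.succ (rank (A i))

theorem rank_elt_lt : ∀ (x : RName.{u}) (i : x.Idx), (x.elt i).rank < x.rank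
  | mk _ A _ _, i => by
    rw [rank, ← Order.succ_le_iff]
    exact Ordinal.le_iSup (fun i => Order.succ (rank (A i))) i

/-- The natural number `n` in `M[App]`: the set of all `⟨k, k⟩` with `k < n`. -/
def num (n : ℕ) : RName.{u} :=
  mk (ULift.{u} (Fin n)) (fun k => num k.down.1) (fun k e _ => e = k.down.1)
    (fun _ _ _ _ _ h => h)
termination_by n
decreasing_by exact k.down.2

/-- The canonical image in `M[App]` of a set `X` of naturals of the ground model: the set of all
`⟨m, m⟩` with `m ∈ X`. -/
def ofSet (X : Set ℕ) : RName.{u} :=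
  mk (ULift.{u} X) (fun m => num m.down.1) (fun m e _ => e = m.down.1) (fun _ _ _ _ _ h => h)

/-- The set of natural numbers of `M[App]`. -/
def omega : RName.{u} := ofSet Set.univ

end RName

/-- The interpretation of a formula: the relation `σ ⊨ "e ⊩ φ"` of a node `σ` and a realizer `e`.
The components of a realizer are `e.unpair.1` and `e.unpair.2`. -/
abbrev RProp := Node → ℕ → Prop

section

variable (F : ℕ → ℕ → Set ℕ)

/-- `σ ⊨ "e ⊩ x = y"`; see `rEq_iff` for the clause in terms of `rMem`. -/
def rEq (x y : RName.{u}) : RProp := fun σ e => ∀ τ, σ <+: τ →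
  (∀ i f, x.lab i f τ → ∃ v ∈ app.{u} F τ e.unpair.1 f,
    ∃ j, y.lab j v.unpair.1 τ ∧ rEq (x.elt i) (y.elt j) τ v.unpair.2) ∧
  (∀ j f, y.lab j f τ → ∃ v ∈ app.{u} F τ e.unpair.2 f,
    ∃ i, x.lab i v.unpair.1 τ ∧ rEq (y.elt j) (x.elt i) τ v.unpair.2)
termination_by max x.rank y.rank
decreasing_by
  · exact max_lt_max (x.rank_elt_lt i) (y.rank_elt_lt j)
  · rw [max_comm x.rank]
    exact max_lt_max (y.rank_elt_lt j) (x.rank_elt_lt i)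

/-- `σ ⊨ "e ⊩ x ∈ y"`. -/
def rMem (x y : RName.{u}) : RProp := fun σ e =>
  ∃ j, y.lab j e.unpair.1 σ ∧ rEq F x (y.elt j) σ e.unpair.2

theorem rEq_iff (x y : RName.{u}) (σ : Node) (e : ℕ) :
    rEq F x y σ e ↔ ∀ τ, σ <+: τ →
      (∀ i f, x.lab i f τ → ∃ v ∈ app.{u} F τ e.unpair.1 f, rMem F (x.elt i) y τ v) ∧
      (∀ j f, y.lab j f τ → ∃ v ∈ app.{u} F τ e.unpair.2 f, rMem F (y.elt j) x τ v) := by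
  rw [rEq]; rfl

/-- `φ ∧ ψ`. -/
def rAnd (A B : RProp) : RProp := fun σ e => A σ e.unpair.1 ∧ B σ e.unpair.2

/-- `φ ∨ ψ`. -/
def rOr (A B : RProp) : RProp := fun σ e =>
  (e.unpair.1 = 0 ∧ A σ e.unpair.2) ∨ (e.unpair.1 ≠ 0 ∧ B σ e.unpair.2)

/-- `φ → ψ`. -/
def rImp (A B : RProp) : RProp := fun σ e =>
  ∀ τ, σ <+: τ → ∀ f, A τ f → ∃ v ∈ app.{u} F τ e f, B τ v

/-- `⊥`. -/
def rFalse : RProp := fun _ _ => False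

/-- `¬ φ`. -/
def rNot (A : RProp) : RProp := rImp.{u} F A rFalse

/-- `∀ x φ(x)`, with `x` ranging over all sets of `M[App]`. -/
def rAll (A : RName.{u} → RProp) : RProp := fun σ e => ∀ τ, σ <+: τ → ∀ x, A x τ e

/-- `∀ m ∈ ω φ(m)`, with the naturals of `M[App]` identified with those of `M`. -/
def rAllNat (A : ℕ → RProp) : RProp := fun σ e =>
  ∀ τ, σ <+: τ → ∀ m, ∃ v ∈ app.{u} F τ e m, A m τ v

/-- `∃ m ∈ ω φ(m)`, with the naturals of `M[App]` identified with those of `M`. -/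
def rExNat (A : ℕ → RProp) : RProp := fun σ e => A e.unpair.1 σ e.unpair.2

/-- A decidable statement about given natural numbers, evaluated in the ground model. -/
def rFact (p : Prop) : RProp := fun _ _ => p

/-- `X ⊆ Y`. -/
def rSubset (X Y : RName.{u}) : RProp :=
  rAll fun x => rImp.{u} F (rMem F x X) (rMem F x Y)

/-- "`X` is decidable", for a set `X` of naturals: `∀ x ∈ ω (x ∈ X ∨ ¬ x ∈ X)`. -/
def rDecidable (X : RName.{u}) : RProp :=
  rAll fun x => rImp.{u} F (rMem F x RName.omega)
    (rOr (rMem F x X) (rNot.{u} F (rMem F x X)))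

/-- "`X` is an infinite branch through the binary tree", with finite binary sequences coded by
natural numbers: `X` is a set of nodes of the binary tree, it is closed under initial segments,
and for every `m` it has exactly one element of length `m`. -/
def rIsBranch (X : RName.{u}) : RProp :=
  rAnd (rSubset F X (RName.ofSet (Set.range fun b : List Bool => Encodable.encode b))) <|
  rAnd (rAllNat.{u} F fun s => rAllNat.{u} F fun t =>
    rImp.{u} F (rFact (∃ a b : List Bool,
        Encodable.encode a = s ∧ Encodable.encode b = t ∧ a <+: b)) <|
      rImp.{u} F (rMem F (RName.num t) X) (rMem F (RName.num s) X)) <|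
  rAllNat.{u} F fun m => rExNat fun s =>
    rAnd (rAnd (rFact (∃ a : List Bool, Encodable.encode a = s ∧ a.length = m))
        (rMem F (RName.num s) X)) <|
      rAllNat.{u} F fun t =>
        rImp.{u} F (rAnd (rFact (∃ b : List Bool, Encodable.encode b = t ∧ b.length = m))
            (rMem F (RName.num t) X))
          (rEq F (RName.num.{u} t) (RName.num s))

end

/-- `σ ⊨ "M[App] ⊨ φ"`: some realizer of `φ` exists at `σ`. -/
def Holds (σ : Node) (A : RProp) : Prop := ∃ e, A σ e

/-! ## Turing reducibility of sets of naturals in the ground model -/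

open Classical in
/-- The characteristic function of a set of naturals. -/
def chi (X : Set ℕ) : ℕ →. ℕ := fun n => Part.some (if n ∈ X then 1 else 0)

/-- `X` is Turing computable in `Y`. -/
def ComputableFrom (X Y : Set ℕ) : Prop := TuringReducible (chi X) (chi Y)

/-- `R_{n-1}`, where `R_{-1}` is the empty set. -/
def prevReal (r : ℕ → Set ℕ) : ℕ → Set ℕ
  | 0 => ∅
  | n + 1 => r n

end KripkeReal

end

/-!
At a node `σ` of length `n` the oracle answers exactly the queries about the first `n` slices of
`R`, because a later node may still put any element into any later slice (`oracleAt_eq`). The `k`-th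
slice is a finite variation of `R_k` and the degrees increase, so the partial oracle at `σ` has the
Turing degree of `R_{n-1}`: a set is computable in `R_{n-1}` if and only if some index of `App` computes it at `σ`
(`computableFrom_prevReal_iff`). Such an index computes the same function at all later nodes, since
evaluation is monotone in the oracle (`OCode.eval_mono`).

It remains to compare the sets computed at `σ` with the decidable sets of `M[App]`. If a set `X` of
naturals is decidable, the decision of `m ∈ X` taken at `σ` is final, and the set `Y` of the `m` that
are accepted at `σ` satisfies `X = Y̌` (`exists_rEq_ofSet_of_rDecidable`). Conversely, if `X = Y̌` and
`Y` is computed at `σ`, then `m ∈ X` is decided by computing whether `m ∈ Y`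
(`holds_rDecidable_of_rEq_ofSet`). For a branch `X`, the realizer of "there is exactly one element of
each length" computes that element, and `m ∈ X` is decided by a comparison with it
(`holds_rDecidable_of_rIsBranch`). The first claim is the second one for canonical sets, since
`X̌ = Y̌` is realized only if `X = Y` (`ofSet_inj`).

Realizers have to treat all sets `x` that are equal to a natural `m`, and not only the canonical one;
this takes a realizer of the transitivity of equality that is computable from the given realizers
(`exists_rEq_trans`). Equality is defined by recursion on sets, so its realizers call themselves. No
recursion theorem and no universal program is used: the index of the composed realizer is written
down from the given indices, and a program refers to itself by getting its own index as an argument.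
-/

namespace KripkeReal

/-! ### Programs with an oracle -/

namespace OCode

theorem eval_mono {O O' : ℕ →. ℕ} (h : ∀ p, ∀ v ∈ O p, v ∈ O' p) (c : OCode) :
    ∀ x, ∀ v ∈ c.eval O x, v ∈ c.eval O' x := by
  induction c with
  | zero | succ | left | right => exact fun x v hv => hv
  | oracle => exact h
  | pair c d ihc ihd =>
    intro x v hv
    simp only [eval, Seq.seq, Part.map_eq_map, Part.bind_map, Part.mem_bind_iff,
      Part.mem_map_iff] at hv ⊢
    obtain ⟨a, ha, b, hb, rfl⟩ := hv
    exact ⟨a, ihc _ _ ha, b, ihd _ _ hb, rfl⟩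
  | comp c d ihc ihd =>
    intro x v hv
    obtain ⟨a, ha, hv⟩ := Part.mem_bind_iff.1 hv
    exact Part.mem_bind_iff.2 ⟨a, ihd _ _ ha, ihc _ _ hv⟩
  | prec c d ihc ihd =>
    intro x
    simp only [eval]
    induction x.unpair.2 with
    | zero => exact ihc _
    | succ y ih =>
      intro v hv
      simp only [Part.bind_eq_bind, Part.mem_bind_iff] at hv ⊢
      obtain ⟨a, ha, hv⟩ := hv
      exact ⟨a, ih _ ha, ihd _ _ hv⟩
  | rfind c ih =>
    intro x v hv
    obtain ⟨hv, hlt⟩ := Nat.mem_rfind.1 hv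
    have key : ∀ (b : Bool) (m : ℕ), b ∈ (fun k => decide (k = 0)) <$> c.eval O (Nat.pair x m) →
        b ∈ (fun k => decide (k = 0)) <$> c.eval O' (Nat.pair x m) := by
      intro b m hb
      obtain ⟨a, ha, rfl⟩ := (Part.mem_map_iff _).1 hb
      exact Part.mem_map _ (ih _ _ ha)
    exact Nat.mem_rfind.2 ⟨key _ _ hv, fun {m} hm => key _ _ (hlt hm)⟩

theorem recursiveIn_eval (O : ℕ →. ℕ) (c : OCode) : Nat.RecursiveIn {O} (c.eval O) := by
  induction c with
  | zero => exact .zero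
  | succ => exact .succ
  | left => exact .left
  | right => exact .right
  | oracle => exact .oracle O rfl
  | pair c d ihc ihd => exact .pair ihc ihd
  | comp c d ihc ihd => exact .comp ihc ihd
  | prec c d ihc ihd => exact .prec ihc ihd
  | rfind c ih => exact .rfind ih

/-- For `S = {O}` this is the converse of `recursiveIn_eval`; for `S = ∅` it says that one program
computes a given partial recursive function with every oracle. -/
theorem exists_eval_eq {S : Set (ℕ →. ℕ)} {f : ℕ →. ℕ} (hf : Nat.RecursiveIn S f) :
    ∃ c : OCode, ∀ O, S ⊆ {O} → c.eval O = f := by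
  induction hf with
  | zero => exact ⟨.zero, fun _ _ => rfl⟩
  | succ => exact ⟨.succ, fun _ _ => rfl⟩
  | left => exact ⟨.left, fun _ _ => rfl⟩
  | right => exact ⟨.right, fun _ _ => rfl⟩
  | oracle g hg => exact ⟨.oracle, fun O hO => (hO hg).symm⟩
  | pair _ _ ih₁ ih₂ =>
    obtain ⟨c, hc⟩ := ih₁
    obtain ⟨d, hd⟩ := ih₂
    exact ⟨.pair c d, fun O hO => by simp only [eval, hc O hO, hd O hO]; rfl⟩
  | comp _ _ ih₁ ih₂ =>
    obtain ⟨c, hc⟩ := ih₁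
    obtain ⟨d, hd⟩ := ih₂
    exact ⟨.comp c d, fun O hO => by simp only [eval, hc O hO, hd O hO]; rfl⟩
  | prec _ _ ih₁ ih₂ =>
    obtain ⟨c, hc⟩ := ih₁
    obtain ⟨d, hd⟩ := ih₂
    exact ⟨.prec c d, fun O hO => by simp only [eval, hc O hO, hd O hO]; rfl⟩
  | rfind _ ih =>
    obtain ⟨c, hc⟩ := ih
    exact ⟨.rfind c, fun O hO => by simp only [eval, hc O hO]; rfl⟩

/-- The index of the pairing of two programs. -/
def pairIdx (a b : ℕ) : ℕ := 4 * Nat.pair a b + 5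

/-- The index of the composition of two programs. -/
def compIdx (a b : ℕ) : ℕ := 4 * Nat.pair a b + 7

/-- The index of the primitive recursion on two programs. -/
def precIdx (a b : ℕ) : ℕ := 4 * Nat.pair a b + 6

/-- The index of the minimization of a program. -/
def rfindIdx (a : ℕ) : ℕ := 4 * a + 8

/-- An index of the constant function with value `n`. -/
def constIdx (n : ℕ) : ℕ := Nat.rec 0 (fun _ e => compIdx 1 e) n

/-- An index of the identity: `⟨left, right⟩`. -/
def idIdx : ℕ := pairIdx 2 3

/-- An index of `f ↦ {a}(⟨x, f⟩)`, as in the s-m-n theorem. -/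
def curryIdx (a x : ℕ) : ℕ := compIdx a (pairIdx (constIdx x) idIdx)

theorem ofIndex_add_five (n : ℕ) : ofIndex (n + 5) =
    match n.bodd, n.div2.bodd with
    | false, false => .pair (ofIndex n.div2.div2.unpair.1) (ofIndex n.div2.div2.unpair.2)
    | false, true => .comp (ofIndex n.div2.div2.unpair.1) (ofIndex n.div2.div2.unpair.2)
    | true, false => .prec (ofIndex n.div2.div2.unpair.1) (ofIndex n.div2.div2.unpair.2)
    | true, true => .rfind (ofIndex n.div2.div2) := by
  rw [ofIndex]

theorem ofIndex_bit (b₀ b₁ : Bool) (m : ℕ) : ofIndex (Nat.bit b₀ (Nat.bit b₁ m) + 5) =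
    match b₀, b₁ with
    | false, false => .pair (ofIndex m.unpair.1) (ofIndex m.unpair.2)
    | false, true => .comp (ofIndex m.unpair.1) (ofIndex m.unpair.2)
    | true, false => .prec (ofIndex m.unpair.1) (ofIndex m.unpair.2)
    | true, true => .rfind (ofIndex m) := by
  rw [ofIndex_add_five]
  simp only [Nat.bodd_bit, Nat.div2_bit]

theorem ofIndex_pairIdx (a b : ℕ) : ofIndex (pairIdx a b) = .pair (ofIndex a) (ofIndex b) := by
  have h := ofIndex_bit false false (Nat.pair a b)
  simp only [Nat.bit_val, Nat.unpair_pair] at h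
  rw [pairIdx, ← h]
  congr 1
  simp; omega

theorem ofIndex_compIdx (a b : ℕ) : ofIndex (compIdx a b) = .comp (ofIndex a) (ofIndex b) := by
  have h := ofIndex_bit false true (Nat.pair a b)
  simp only [Nat.bit_val, Nat.unpair_pair] at h
  rw [compIdx, ← h]
  congr 1
  simp; omega

theorem ofIndex_precIdx (a b : ℕ) : ofIndex (precIdx a b) = .prec (ofIndex a) (ofIndex b) := by
  have h := ofIndex_bit true false (Nat.pair a b)
  simp only [Nat.bit_val, Nat.unpair_pair] at h
  rw [precIdx, ← h]
  congr 1
  simp; omega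

theorem ofIndex_rfindIdx (a : ℕ) : ofIndex (rfindIdx a) = .rfind (ofIndex a) := by
  have h := ofIndex_bit true true a
  simp only [Nat.bit_val] at h
  rw [rfindIdx, ← h]
  congr 1
  simp; omega

theorem ofIndex_surjective : Function.Surjective ofIndex := by
  intro c
  induction c with
  | zero => exact ⟨0, by rw [ofIndex]⟩
  | succ => exact ⟨1, by rw [ofIndex]⟩
  | left => exact ⟨2, by rw [ofIndex]⟩
  | right => exact ⟨3, by rw [ofIndex]⟩
  | oracle => exact ⟨4, by rw [ofIndex]⟩
  | pair c d ihc ihd =>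
    obtain ⟨a, rfl⟩ := ihc
    obtain ⟨b, rfl⟩ := ihd
    exact ⟨_, ofIndex_pairIdx a b⟩
  | comp c d ihc ihd =>
    obtain ⟨a, rfl⟩ := ihc
    obtain ⟨b, rfl⟩ := ihd
    exact ⟨_, ofIndex_compIdx a b⟩
  | prec c d ihc ihd =>
    obtain ⟨a, rfl⟩ := ihc
    obtain ⟨b, rfl⟩ := ihd
    exact ⟨_, ofIndex_precIdx a b⟩
  | rfind c ih =>
    obtain ⟨a, rfl⟩ := ih
    exact ⟨_, ofIndex_rfindIdx a⟩

theorem exists_index_of_computable {f : ℕ → ℕ} (hf : Computable f) :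
    ∃ e, ∀ O n, (ofIndex e).eval O n = Part.some (f n) := by
  have hf' : Nat.Partrec fun n => Part.some (f n) := Partrec.nat_iff.1 hf
  obtain ⟨c, hc⟩ := exists_eval_eq (S := ∅) hf'.recursiveIn
  obtain ⟨e, rfl⟩ := ofIndex_surjective c
  exact ⟨e, fun O n => by rw [hc O (Set.empty_subset _)]⟩

section

variable {O : ℕ →. ℕ} {a b x v w : ℕ}

theorem pair_mem_eval (hv : v ∈ (ofIndex a).eval O x) (hw : w ∈ (ofIndex b).eval O x) :
    Nat.pair v w ∈ (ofIndex (pairIdx a b)).eval O x := by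
  simp only [ofIndex_pairIdx, eval, Seq.seq, Part.map_eq_map, Part.bind_map, Part.mem_bind_iff,
    Part.mem_map_iff]
  exact ⟨v, hv, w, hw, rfl⟩

theorem comp_mem_eval (hv : v ∈ (ofIndex b).eval O x) (hw : w ∈ (ofIndex a).eval O v) :
    w ∈ (ofIndex (compIdx a b)).eval O x := by
  rw [ofIndex_compIdx]
  exact Part.mem_bind_iff.2 ⟨v, hv, hw⟩

theorem zero_mem_eval : 0 ∈ (ofIndex 0).eval O x := by
  rw [ofIndex]; exact Part.mem_some _

theorem succ_mem_eval : x + 1 ∈ (ofIndex 1).eval O x := by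
  rw [ofIndex]; exact Part.mem_some _

theorem left_mem_eval : x.unpair.1 ∈ (ofIndex 2).eval O x := by
  rw [ofIndex]; exact Part.mem_some _

theorem right_mem_eval : x.unpair.2 ∈ (ofIndex 3).eval O x := by
  rw [ofIndex]; exact Part.mem_some _

theorem const_mem_eval (n : ℕ) : n ∈ (ofIndex (constIdx n)).eval O x := by
  induction n with
  | zero => exact zero_mem_eval
  | succ n ih => exact comp_mem_eval ih succ_mem_eval

theorem id_mem_eval : x ∈ (ofIndex idIdx).eval O x := by
  simpa using! pair_mem_eval (O := O) (x := x) left_mem_eval right_mem_eval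

theorem curry_mem_eval (hv : v ∈ (ofIndex a).eval O (Nat.pair w x)) :
    v ∈ (ofIndex (curryIdx a w)).eval O x :=
  comp_mem_eval (pair_mem_eval (const_mem_eval w) id_mem_eval) hv

/-- The base case of a primitive recursion: the step program is not run. -/
theorem prec_zero_mem_eval (hv : v ∈ (ofIndex a).eval O x) :
    v ∈ (ofIndex (precIdx a b)).eval O (Nat.pair x 0) := by
  simpa [ofIndex_precIdx, eval] using! hv

theorem prec_one_mem_eval (hw : w ∈ (ofIndex a).eval O x)
    (hv : v ∈ (ofIndex b).eval O (Nat.pair x (Nat.pair 0 w))) :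
    v ∈ (ofIndex (precIdx a b)).eval O (Nat.pair x 1) := by
  simp only [ofIndex_precIdx, eval, Nat.unpair_pair]
  exact Part.mem_bind_iff.2 ⟨w, hw, hv⟩

end

theorem primrec_unpair_fst : Primrec fun n : ℕ => n.unpair.1 := Primrec.fst.comp Primrec.unpair

theorem primrec_unpair_snd : Primrec fun n : ℕ => n.unpair.2 := Primrec.snd.comp Primrec.unpair

theorem exists_index_of_primrec {f : ℕ → ℕ} (hf : Primrec f) :
    ∃ e, ∀ O n, f n ∈ (ofIndex e).eval O n := by
  obtain ⟨e, he⟩ := exists_index_of_computable hf.to_comp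
  exact ⟨e, fun O n => he O n ▸ Part.mem_some _⟩

theorem primrec_pairIdx : Primrec₂ pairIdx :=
  Primrec.nat_add.comp (Primrec.nat_mul.comp (Primrec.const 4) Primrec₂.natPair) (Primrec.const 5)

theorem primrec_compIdx : Primrec₂ compIdx :=
  Primrec.nat_add.comp (Primrec.nat_mul.comp (Primrec.const 4) Primrec₂.natPair) (Primrec.const 7)

theorem primrec_constIdx : Primrec constIdx :=
  Primrec.nat_rec₁ 0 (primrec_compIdx.comp (Primrec.const 1) Primrec.snd)

theorem primrec_curryIdx : Primrec₂ curryIdx :=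
  primrec_compIdx.comp Primrec.fst
    (primrec_pairIdx.comp (primrec_constIdx.comp Primrec.snd) (Primrec.const idIdx))

end OCode

/-! ### The oracle at a node -/

theorem ofNat_equiv_iff {m n : ℕ} : (PSet.ofNat.{u} m).Equiv (PSet.ofNat.{u} n) ↔ m = n := by
  have mem_of_lt : ∀ {m n : ℕ}, m < n → PSet.ofNat.{u} m ∈ PSet.ofNat.{u} n := by
    intro m n hmn
    induction n with
    | zero => omega
    | succ n ih =>
      rw [PSet.ofNat, PSet.mem_insert_iff]
      rcases Nat.lt_succ_iff_lt_or_eq.1 hmn with h | rfl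
      · exact Or.inr (ih h)
      · exact Or.inl (PSet.Equiv.refl _)
  refine ⟨fun h => ?_, fun h => h ▸ PSet.Equiv.rfl⟩
  rcases lt_trichotomy m n with hmn | hmn | hmn
  · exact absurd ((PSet.Mem.congr_right h).2 (mem_of_lt hmn)) (PSet.mem_irrefl _)
  · exact hmn
  · exact absurd ((PSet.Mem.congr_right h).1 (mem_of_lt hmn)) (PSet.mem_irrefl _)

namespace KSet

theorem forcesEq_check : ∀ (x y : PSet.{u}) (σ : Node),
    forcesEq (check x) (check y) σ ↔ x.Equiv y
  | ⟨ι, A⟩, ⟨κ, B⟩, σ => by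
    simp only [check, forcesEq, true_and, forall_const, forcesEq_check, PSet.Equiv]
    exact ⟨fun h => h σ (List.prefix_refl σ), fun h _ _ => h⟩

end KSet

theorem forcesMem_specialR {F : ℕ → ℕ → Set ℕ} {p : ℕ} {σ : Node} :
    KSet.forcesMem (KSet.check (PSet.ofNat.{u} p)) (specialR.{u} F) σ ↔ p ∈ stage F σ := by
  simp only [specialR, KSet.forcesMem, KSet.forcesEq_check, ofNat_equiv_iff]
  exact ⟨fun ⟨j, hj, h⟩ => h ▸ hj, fun h => ⟨⟨p⟩, h, rfl⟩⟩

open Classical in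
theorem oracleAt_def (F : ℕ → ℕ → Set ℕ) (σ : Node) (p : ℕ) : oracleAt.{u} F σ p =
    if p ∈ stage F σ then Part.some 1
    else if ∀ τ, σ <+: τ → p ∉ stage F τ then Part.some 0 else Part.none := by
  simp only [oracleAt, forcesMem_specialR]

theorem oracleAt_mono {F : ℕ → ℕ → Set ℕ} {σ τ : Node} (h : σ <+: τ) (p v : ℕ)
    (hv : v ∈ oracleAt.{u} F σ p) : v ∈ oracleAt.{u} F τ p := by
  rw [oracleAt_def] at hv ⊢
  split_ifs at hv with h₁ h₂
  · rwa [if_pos (stage_mono F p σ τ h h₁)]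
  · rwa [if_neg (h₂ τ h), if_pos fun ρ hρ => h₂ ρ (h.trans hρ)]
  · exact absurd hv (Part.notMem_none v)

theorem mem_app_mono {F : ℕ → ℕ → Set ℕ} {σ τ : Node} (h : σ <+: τ) {e x v : ℕ}
    (hv : v ∈ app.{u} F σ e x) : v ∈ app.{u} F τ e x :=
  OCode.eval_mono (oracleAt_mono h) _ _ _ hv

open Classical in
/-- The first `|σ|` slices of `R` are settled at `σ`, and nothing else is: every `s` belongs to
some finite variation of `r k`, so that an extension of `σ` can still put `⟨k, s⟩` into `R`
when `|σ| ≤ k`. -/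
theorem oracleAt_eq {r : ℕ → Set ℕ} {F : ℕ → ℕ → Set ℕ}
    (hF : ∀ n, Set.range (F n) = {A : Set ℕ | (symmDiff A (r n)).Finite}) (σ : Node) (p : ℕ) :
    oracleAt.{u} F σ p =
      if p.unpair.1 < σ.length then Part.some (if p ∈ stage F σ then 1 else 0) else Part.none := by
  rw [oracleAt_def]
  by_cases hp : p ∈ stage F σ
  · obtain ⟨i, hi, -⟩ := id hp
    rw [if_pos hp, if_pos (List.getElem?_eq_some_iff.1 hi).1, if_pos hp]
  rw [if_neg hp]
  by_cases hlt : p.unpair.1 < σ.length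
  · rw [if_pos hlt, if_neg hp, if_pos]
    rintro _ ⟨ρ, rfl⟩ ⟨i, hi, hs⟩
    exact hp ⟨i, by rwa [List.getElem?_append_left hlt] at hi, hs⟩
  · rw [if_neg hlt, if_neg]
    obtain ⟨i, hi⟩ : insert p.unpair.2 (r p.unpair.1) ∈ Set.range (F p.unpair.1) := by
      rw [hF]
      refine (Set.finite_singleton p.unpair.2).subset ?_
      rintro s (⟨hs, hs'⟩ | ⟨hs, hs'⟩)
      · exact hs.resolve_right hs'
      · exact absurd (Or.inr hs) hs'
    intro h
    refine h (σ ++ List.replicate (p.unpair.1 + 1) i) (List.prefix_append _ _) ⟨i, ?_, ?_⟩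
    · rw [List.getElem?_append_right (not_lt.1 hlt), List.getElem?_replicate,
        if_pos (by omega)]
    · rw [hi]; exact Or.inl rfl

/-! ### The degree of the oracle at a node -/

/-- Composition of a computable function with two functions that are recursive in oracles. -/
theorem recursiveIn_map₂ {S : Set (ℕ →. ℕ)} {f g : ℕ → ℕ} {K : ℕ → ℕ → ℕ}
    (hf : Nat.RecursiveIn S fun n => Part.some (f n))
    (hg : Nat.RecursiveIn S fun n => Part.some (g n)) (hK : Computable₂ K) :
    Nat.RecursiveIn S fun n => Part.some (K (f n) (g n)) := by
  have hK' : Nat.Partrec fun p => Part.some (K p.unpair.1 p.unpair.2) :=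
    Partrec.nat_iff.1 (hK.comp (Computable.fst.comp Computable.unpair)
      (Computable.snd.comp Computable.unpair))
  refine (hK'.recursiveIn.comp (hf.pair hg)).of_eq fun n => ?_
  simp [Seq.seq]

theorem recursiveIn_of_computable {S : Set (ℕ →. ℕ)} {f : ℕ → ℕ} (hf : Computable f) :
    Nat.RecursiveIn S fun n => Part.some (f n) :=
  Nat.Partrec.recursiveIn (Partrec.nat_iff.1 hf)

theorem computableFrom_iff {X Y : Set ℕ} :
    ComputableFrom X Y ↔ Nat.RecursiveIn {chi Y} (chi X) :=
  RecursiveIn.iff_nat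

theorem primrecPred_mem_of_finite {D : Set ℕ} (hD : D.Finite) : PrimrecPred (· ∈ D) := by
  have h : PrimrecPred fun s : ℕ => ∃ a ∈ hD.toFinset.toList, a = s :=
    (Primrec.eq (α := ℕ)).exists_mem_list.comp (Primrec.const _) Primrec.id
  exact h.of_eq fun s => by simp

theorem computableFrom_of_finite_symmDiff {A B : Set ℕ} (h : (symmDiff A B).Finite) :
    ComputableFrom A B := by
  classical
  rw [computableFrom_iff]
  have hK : Computable₂ fun s b : ℕ => if s ∈ symmDiff A B then 1 - b else b :=
    (Primrec.ite ((primrecPred_mem_of_finite h).comp Primrec.fst)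
      (Primrec.nat_sub.comp (Primrec.const 1) Primrec.snd) Primrec.snd).to_comp
  refine (recursiveIn_map₂ (recursiveIn_of_computable Computable.id)
    (.oracle (chi B) (Set.mem_singleton _)) hK).of_eq fun s => ?_
  by_cases hA : s ∈ A <;> by_cases hB : s ∈ B <;> simp [chi, Set.mem_symmDiff, hA, hB]

theorem computableFrom_prevReal {r : ℕ → Set ℕ}
    (hr : ∀ m n, m < n → ComputableFrom (r m) (r n)) {k n : ℕ} (hk : k < n) :
    ComputableFrom (r k) (prevReal r n) := by
  obtain _ | n := n
  · omega
  rcases Nat.lt_succ_iff_lt_or_eq.1 hk with h | rfl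
  · exact hr k n h
  · exact TuringReducible.refl _

theorem finite_symmDiff_variation {r : ℕ → Set ℕ} {F : ℕ → ℕ → Set ℕ}
    (hF : ∀ n, Set.range (F n) = {A : Set ℕ | (symmDiff A (r n)).Finite})
    (k i : ℕ) : (symmDiff (F k i) (r k)).Finite := by
  have h : F k i ∈ Set.range (F k) := ⟨i, rfl⟩
  rwa [hF] at h

open Classical in
/-- The join of the slices of `R` below `k` that are settled at `σ` is computable in `R_{|σ|-1}`. -/
theorem recursiveIn_stage_lt {r : ℕ → Set ℕ} {F : ℕ → ℕ → Set ℕ}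
    (hF : ∀ n, Set.range (F n) = {A : Set ℕ | (symmDiff A (r n)).Finite})
    (hr : ∀ m n, m < n → ComputableFrom (r m) (r n)) (σ : Node)
    (k : ℕ) (hk : k ≤ σ.length) : Nat.RecursiveIn {chi (prevReal r σ.length)}
      fun p => Part.some (if p.unpair.1 < k ∧ p ∈ stage F σ then 1 else 0) := by
  induction k with
  | zero =>
    exact (recursiveIn_of_computable (Computable.const 0)).of_eq fun p => by simp
  | succ k ih =>
    have hslice : Nat.RecursiveIn {chi (prevReal r σ.length)}
        fun p => Part.some (if p.unpair.2 ∈ F k σ[k] then 1 else 0) := by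
      have h := (TuringReducible.trans
        (computableFrom_of_finite_symmDiff (finite_symmDiff_variation hF k σ[k]))
        (computableFrom_prevReal hr hk))
      exact ((RecursiveIn.iff_nat.1 h).comp .right).of_eq fun p =>
        Part.bind_some _ _
    have hK₁ : Computable₂ fun p a : ℕ => if p.unpair.1 = k then a else 0 :=
      (Primrec.ite (Primrec.eq.comp (Primrec.fst.comp (Primrec.unpair.comp Primrec.fst))
        (Primrec.const k)) Primrec.snd (Primrec.const 0)).to_comp
    have hK₂ : Computable₂ fun a b : ℕ => a + b := Primrec.nat_add.to_comp
    refine (recursiveIn_map₂ (recursiveIn_map₂ (recursiveIn_of_computable Computable.id) hslice hK₁)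
      (ih (by omega)) hK₂).of_eq fun p => ?_
    congr 1
    rcases lt_trichotomy p.unpair.1 k with h | h | h
    · simp [h.ne, h, h.trans (Nat.lt_succ_self k)]
    · have hp : p ∈ stage F σ ↔ p.unpair.2 ∈ F k σ[k] := by
        simp [stage, h, List.getElem?_eq_getElem (Nat.lt_of_succ_le hk)]
      simp [h, hp]
    · simp [h.ne', h.not_gt, show ¬ p.unpair.1 < k + 1 by omega]

theorem recursiveIn_oracleAt {r : ℕ → Set ℕ} {F : ℕ → ℕ → Set ℕ}
    (hF : ∀ n, Set.range (F n) = {A : Set ℕ | (symmDiff A (r n)).Finite})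
    (hr : ∀ m n, m < n → ComputableFrom (r m) (r n)) (σ : Node) :
    Nat.RecursiveIn {chi (prevReal r σ.length)} (oracleAt.{u} F σ) := by
  classical
  have hG : Nat.Partrec fun p =>
      if p.unpair.1.unpair.1 < σ.length then Part.some p.unpair.2 else Part.none := by
    have hc : Computable fun p : ℕ => decide (p.unpair.1.unpair.1 < σ.length) :=
      (PrimrecPred.decide (Primrec.nat_lt.comp (Primrec.fst.comp (Primrec.unpair.comp
        (Primrec.fst.comp Primrec.unpair))) (Primrec.const σ.length))).to_comp
    have hs : Partrec fun p : ℕ => Part.some p.unpair.2 :=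
      Computable.snd.comp Computable.unpair
    refine Partrec.nat_iff.1 ((Partrec.cond hc hs Partrec.none).of_eq fun p => ?_)
    by_cases h : p.unpair.1.unpair.1 < σ.length <;> simp [h]
  have h := hG.recursiveIn.comp ((recursiveIn_of_computable Computable.id).pair
    (recursiveIn_stage_lt hF hr σ σ.length le_rfl))
  refine h.of_eq fun p => ?_
  rw [oracleAt_eq hF]
  by_cases hp : p.unpair.1 < σ.length <;> simp [hp, Seq.seq]

theorem recursiveIn_chi_prevReal {r : ℕ → Set ℕ} {F : ℕ → ℕ → Set ℕ}
    (hF : ∀ n, Set.range (F n) = {A : Set ℕ | (symmDiff A (r n)).Finite})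
    (σ : Node) :
    Nat.RecursiveIn {oracleAt.{u} F σ} (chi (prevReal r σ.length)) := by
  classical
  rcases σ.eq_nil_or_concat' with rfl | ⟨ρ, i, rfl⟩
  · exact (recursiveIn_of_computable (Computable.const 0)).of_eq fun s => by simp [chi, prevReal]
  have hlen : (ρ ++ [i]).length = ρ.length + 1 := by simp
  rw [hlen, prevReal]
  have hslice : Nat.RecursiveIn {oracleAt.{u} F (ρ ++ [i])} (chi (F ρ.length i)) := by
    have hpair : Computable fun s : ℕ => Nat.pair ρ.length s :=
      (Primrec₂.natPair.comp (Primrec.const _) Primrec.id).to_comp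
    refine ((Nat.RecursiveIn.oracle _ (Set.mem_singleton _)).comp (recursiveIn_of_computable hpair)).of_eq
      fun s => ?_
    refine (Part.bind_some _ _).trans ?_
    simp [oracleAt_eq hF, chi, stage]
  have h := computableFrom_of_finite_symmDiff
    (symmDiff_comm (F ρ.length i) _ ▸ finite_symmDiff_variation hF ρ.length i)
  exact (computableFrom_iff.1 h).subst fun g hg => by rwa [Set.mem_singleton_iff.1 hg]

/-- A set is computable in `R_{|σ|-1}` if and only if some index computes it at `σ`. -/
theorem computableFrom_prevReal_iff {r : ℕ → Set ℕ} {F : ℕ → ℕ → Set ℕ}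
    (hF : ∀ n, Set.range (F n) = {A : Set ℕ | (symmDiff A (r n)).Finite})
    (hr : ∀ m n, m < n → ComputableFrom (r m) (r n)) (σ : Node)
    (X : Set ℕ) : ComputableFrom X (prevReal r σ.length) ↔
      ∃ e, ∀ m, app.{u} F σ e m = chi X m := by
  rw [computableFrom_iff]
  constructor
  · intro h
    obtain ⟨c, hc⟩ := OCode.exists_eval_eq (h.subst (O' := {oracleAt.{u} F σ}) fun g hg => by
      rw [Set.mem_singleton_iff.1 hg]; exact recursiveIn_chi_prevReal hF σ)
    obtain ⟨e, rfl⟩ := OCode.ofIndex_surjective c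
    exact ⟨e, fun m => by rw [app, hc _ subset_rfl]⟩
  · rintro ⟨e, he⟩
    have h := OCode.recursiveIn_eval (oracleAt.{u} F σ) (OCode.ofIndex e)
    refine (h.subst fun g hg => ?_).of_eq he
    rw [Set.mem_singleton_iff.1 hg]
    exact recursiveIn_oracleAt hF hr σ

open OCode

/-! ### Realizers of the laws of equality -/

section

variable {F : ℕ → ℕ → Set ℕ}

theorem rEq_mono {x y : RName.{u}} {σ τ : Node} (h : σ <+: τ) {e : ℕ} (he : rEq F x y σ e) :
    rEq F x y τ e := by
  rw [rEq_iff] at he ⊢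
  exact fun ρ hρ => he ρ (h.trans hρ)

theorem rMem_mono {x y : RName.{u}} {σ τ : Node} (h : σ <+: τ) {e : ℕ} (he : rMem F x y σ e) :
    rMem F x y τ e := by
  obtain ⟨j, hj, he⟩ := he
  refine ⟨j, ?_, rEq_mono h he⟩
  cases y with
  | mk ι A L mono => exact mono _ _ _ _ h hj

theorem rEq_symm {x y : RName.{u}} {σ : Node} {e : ℕ} (h : rEq F x y σ e) :
    rEq F y x σ (Nat.pair e.unpair.2 e.unpair.1) := by
  rw [rEq_iff] at h ⊢
  simp only [Nat.unpair_pair]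
  exact fun τ hτ => (h τ hτ).symm

/-- One number `i = ⟨d, d⟩` realizes `x = x` for every `x`, where `{d}(f) = ⟨f, i⟩`; the index `d`
comes from a program applied to its own index. -/
theorem exists_rEq_refl : ∃ i, ∀ (F : ℕ → ℕ → Set ℕ) (x : RName.{u}) (σ : Node),
    rEq F x x σ i := by
  obtain ⟨c, hc⟩ := exists_index_of_primrec (f := fun p => Nat.pair p.unpair.2
      (Nat.pair (curryIdx p.unpair.1 p.unpair.1) (curryIdx p.unpair.1 p.unpair.1))) <| by
    have h := primrec_curryIdx.comp primrec_unpair_fst primrec_unpair_fst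
    exact Primrec₂.natPair.comp primrec_unpair_snd (Primrec₂.natPair.comp h h)
  set d := curryIdx c c with hd
  have hrun : ∀ O f, Nat.pair f (Nat.pair d d) ∈ (ofIndex d).eval O f := fun O f => by
    simpa [← hd] using curry_mem_eval (hc O (Nat.pair c f))
  refine ⟨Nat.pair d d, fun F x => ?_⟩
  induction x with
  | mk ι A L mono ih =>
    intro σ
    rw [rEq_iff]
    simp only [Nat.unpair_pair]
    have key : ∀ τ (i : ι) f, L i f τ →
        ∃ v ∈ app.{u} F τ d f, rMem F (A i) (RName.mk ι A L mono) τ v :=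
      fun τ i f hi => ⟨_, hrun _ f, i, by simpa using! hi, by simpa using! ih i τ⟩
    exact fun τ _ => ⟨key τ, key τ⟩

/-- One half of a realizer of transitivity: from `a` and `b`, which send labels of `x` into `y` and
labels of `y` into `z`, an index that sends labels of `x` into `z`. The equalities of elements are
composed by the program `q`, which is given its own index. -/
def transHalf (q a b : ℕ) : ℕ :=
  pairIdx (compIdx 2 (compIdx b (compIdx 2 a)))
    (compIdx q (pairIdx (constIdx q)
      (pairIdx (compIdx 3 a) (compIdx 3 (compIdx b (compIdx 2 a))))))

/-- A realizer of `x = z` from realizers `a` of `x = y` and `b` of `y = z`, provided that `q` is an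
index of `⟨q, ⟨a, b⟩⟩ ↦ transRealizer q a b`. -/
def transRealizer (q a b : ℕ) : ℕ :=
  Nat.pair (transHalf q a.unpair.1 b.unpair.1) (transHalf q b.unpair.2 a.unpair.2)

theorem primrec_transHalf {α : Type*} [Primcodable α] {q a b : α → ℕ} (hq : Primrec q)
    (ha : Primrec a) (hb : Primrec b) : Primrec fun x => transHalf (q x) (a x) (b x) := by
  have hw := primrec_compIdx.comp hb (primrec_compIdx.comp (Primrec.const 2) ha)
  exact primrec_pairIdx.comp (primrec_compIdx.comp (Primrec.const 2) hw)
    (primrec_compIdx.comp hq (primrec_pairIdx.comp (primrec_constIdx.comp hq)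
      (primrec_pairIdx.comp (primrec_compIdx.comp (Primrec.const 3) ha)
        (primrec_compIdx.comp (Primrec.const 3) hw))))

theorem primrec_transRealizer {α : Type*} [Primcodable α] {q a b : α → ℕ} (hq : Primrec q)
    (ha : Primrec a) (hb : Primrec b) : Primrec fun x => transRealizer (q x) (a x) (b x) :=
  Primrec₂.natPair.comp
    (primrec_transHalf hq (primrec_unpair_fst.comp ha) (primrec_unpair_fst.comp hb))
    (primrec_transHalf hq (primrec_unpair_snd.comp hb) (primrec_unpair_snd.comp ha))

theorem exists_rEq_trans : ∃ t : ℕ → ℕ → ℕ, Primrec₂ t ∧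
    ∀ (F : ℕ → ℕ → Set ℕ) (x y z : RName.{u}) (σ : Node) (a b : ℕ),
      rEq F x y σ a → rEq F y z σ b → rEq F x z σ (t a b) := by
  obtain ⟨q, hq⟩ := exists_index_of_primrec
    (f := fun p => transRealizer p.unpair.1 p.unpair.2.unpair.1 p.unpair.2.unpair.2) <|
    primrec_transRealizer primrec_unpair_fst (primrec_unpair_fst.comp primrec_unpair_snd)
      (primrec_unpair_snd.comp primrec_unpair_snd)
  have hrun : ∀ {O : ℕ →. ℕ} {a b f v w : ℕ}, v ∈ (ofIndex a).eval O f →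
      w ∈ (ofIndex b).eval O v.unpair.1 →
      Nat.pair w.unpair.1 (transRealizer q v.unpair.2 w.unpair.2) ∈
        (ofIndex (transHalf q a b)).eval O f := by
    intro O a b f v w hv hw
    have hw' := comp_mem_eval (comp_mem_eval hv left_mem_eval) hw
    refine pair_mem_eval (comp_mem_eval hw' left_mem_eval) (comp_mem_eval (pair_mem_eval
      (const_mem_eval q) (pair_mem_eval (comp_mem_eval hv right_mem_eval)
        (comp_mem_eval hw' right_mem_eval))) ?_)
    simpa using hq O (Nat.pair q (Nat.pair v.unpair.2 w.unpair.2))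
  refine ⟨transRealizer q, primrec_transRealizer (Primrec.const q) Primrec.fst Primrec.snd,
    fun F x y => ?_⟩
  induction y generalizing x with
  | mk ι A L mono ih =>
    intro z σ a b hxy hyz
    rw [rEq_iff] at hxy hyz ⊢
    intro τ hτ
    simp only [transRealizer, Nat.unpair_pair]
    constructor
    · intro i f hi
      obtain ⟨v, hv, j, hj, hxj⟩ := (hxy τ hτ).1 i f hi
      obtain ⟨w, hw, k, hk, hjk⟩ := (hyz τ hτ).1 j _ hj
      exact ⟨_, hrun hv hw, k, by simpa using hk, by simpa using ih j _ _ τ _ _ hxj hjk⟩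
    · intro k f hk
      obtain ⟨v, hv, j, hj, hkj⟩ := (hyz τ hτ).2 k f hk
      obtain ⟨w, hw, i, hi, hji⟩ := (hxy τ hτ).2 j _ hj
      exact ⟨_, hrun hv hw, i, by simpa using hi, by simpa using ih j _ _ τ _ _ hkj hji⟩

theorem rMem_congr_left {x y z : RName.{u}} {σ : Node} {a b : ℕ} (hxy : rEq F x y σ a)
    (hxz : rMem F x z σ b) : ∃ c, rMem F y z σ c := by
  obtain ⟨t, -, ht⟩ := exists_rEq_trans.{u}
  obtain ⟨j, hj, hxj⟩ := hxz
  exact ⟨Nat.pair b.unpair.1 _, j, by simpa using hj,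
    by simpa using ht _ _ _ _ _ _ _ (rEq_symm hxy) hxj⟩

/-! ### Natural numbers in the realizability model -/

theorem rMem_num {x : RName.{u}} {n e : ℕ} {σ : Node} :
    rMem F x (RName.num n) σ e ↔
      e.unpair.1 < n ∧ rEq F x (RName.num e.unpair.1) σ e.unpair.2 := by
  rw [RName.num]
  constructor
  · rintro ⟨⟨k⟩, hk, h⟩
    have hk' : e.unpair.1 = k.1 := hk
    rw [hk']
    exact ⟨k.2, h⟩
  · rintro ⟨hk, h⟩
    exact ⟨⟨⟨_, hk⟩⟩, rfl, h⟩

theorem rMem_ofSet {x : RName.{u}} {X : Set ℕ} {e : ℕ} {σ : Node} :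
    rMem F x (RName.ofSet X) σ e ↔
      e.unpair.1 ∈ X ∧ rEq F x (RName.num e.unpair.1) σ e.unpair.2 := by
  constructor
  · rintro ⟨⟨k⟩, hk, h⟩
    have hk' : e.unpair.1 = k.1 := hk
    rw [hk']
    exact ⟨k.2, h⟩
  · rintro ⟨hk, h⟩
    exact ⟨⟨⟨_, hk⟩⟩, rfl, h⟩

theorem rMem_omega {x : RName.{u}} {e : ℕ} {σ : Node} :
    rMem F x RName.omega σ e ↔ rEq F x (RName.num e.unpair.1) σ e.unpair.2 := by
  rw [RName.omega, rMem_ofSet, and_iff_right (Set.mem_univ _)]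

theorem not_rEq_num_of_lt {m n : ℕ} (hmn : m < n) {σ : Node} {e : ℕ} :
    ¬ rEq F (RName.num.{u} m) (RName.num n) σ e := by
  induction m using Nat.strong_induction_on generalizing n e with
  | _ m ih =>
    intro h
    have hn : RName.num.{u} n = RName.mk (ULift.{u} (Fin n)) (fun k => RName.num k.down.1)
      (fun k e _ => e = k.down.1) (fun _ _ _ _ _ h => h) := by rw [RName.num]
    rw [hn, rEq_iff] at h
    -- As `m` is an element of `n`, it is an element of itself, that is, equal to a smaller number.
    obtain ⟨v, -, hv⟩ := (h σ (List.prefix_refl σ)).2 ⟨⟨m, hmn⟩⟩ m rfl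
    obtain ⟨hlt, hv⟩ := rMem_num.1 hv
    exact ih _ hlt hlt (rEq_symm hv)

theorem rEq_num_inj {x : RName.{u}} {m n : ℕ} {σ : Node} {a b : ℕ}
    (hm : rEq F x (RName.num m) σ a) (hn : rEq F x (RName.num n) σ b) : m = n := by
  obtain ⟨t, -, ht⟩ := exists_rEq_trans.{u}
  rcases lt_trichotomy m n with h | h | h
  · exact absurd (ht _ _ _ _ _ _ _ (rEq_symm hm) hn) (not_rEq_num_of_lt h)
  · exact h
  · exact absurd (ht _ _ _ _ _ _ _ (rEq_symm hn) hm) (not_rEq_num_of_lt h)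

theorem mem_of_rMem_num_ofSet {X : Set ℕ} {m e : ℕ} {σ : Node}
    (h : rMem F (RName.num.{u} m) (RName.ofSet X) σ e) : m ∈ X := by
  obtain ⟨i, hi⟩ := exists_rEq_refl.{u}
  obtain ⟨he, h⟩ := rMem_ofSet.1 h
  rwa [rEq_num_inj (hi F _ σ) h]

end

/-! ### Decidable sets in the realizability model -/

section

variable {F : ℕ → ℕ → Set ℕ} {σ : Node} {X : RName.{u}}

/-- Decidability of a set follows from the decision of membership for the canonical naturals,
since the realizers of equality are transitive. -/
theorem holds_rDecidable_of_rAllNat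
    (h : Holds σ (rAllNat.{u} F fun m =>
      rOr (rMem F (RName.num m) X) (rNot.{u} F (rMem F (RName.num m) X)))) :
    Holds σ (rDecidable F X) := by
  obtain ⟨e, he⟩ := h
  obtain ⟨t, ht', ht⟩ := exists_rEq_trans.{u}
  obtain ⟨k, hk⟩ := exists_index_of_primrec (f := fun p =>
      if p.unpair.2.unpair.1 = 0 then
        Nat.pair 0 (Nat.pair p.unpair.2.unpair.2.unpair.1
          (t p.unpair.1.unpair.2 p.unpair.2.unpair.2.unpair.2))
      else Nat.pair 1 0) <| by
    have h₂ := primrec_unpair_snd.comp primrec_unpair_snd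
    exact Primrec.ite
      (Primrec.eq.comp (primrec_unpair_fst.comp primrec_unpair_snd) (Primrec.const 0))
      (Primrec₂.natPair.comp (Primrec.const 0) (Primrec₂.natPair.comp (primrec_unpair_fst.comp h₂)
        (ht'.comp (primrec_unpair_snd.comp primrec_unpair_fst) (primrec_unpair_snd.comp h₂))))
      (Primrec.const _)
  refine ⟨compIdx k (pairIdx idIdx (compIdx e 2)), fun τ' hτ' x τ hτ f hf => ?_⟩
  rw [rMem_omega] at hf
  obtain ⟨v, hv, hv'⟩ := he τ (hτ'.trans hτ) f.unpair.1
  refine ⟨_, comp_mem_eval (pair_mem_eval id_mem_eval (comp_mem_eval left_mem_eval hv))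
    (hk _ _), ?_⟩
  simp only [Nat.unpair_pair]
  rcases hv' with ⟨h0, j, hj, hmj⟩ | ⟨h0, hneg⟩
  · rw [if_pos h0]
    exact Or.inl ⟨by simp, j, by simpa using hj, by simpa using ht _ _ _ _ _ _ _ hf hmj⟩
  · rw [if_neg h0]
    refine Or.inr ⟨by simp, fun ρ hρ g hg => ?_⟩
    obtain ⟨c, hc⟩ := rMem_congr_left (rEq_mono hρ hf) hg
    obtain ⟨w, -, hw⟩ := hneg ρ hρ c hc
    exact hw.elim

theorem holds_rDecidable_of_rEq_ofSet {Y : Set ℕ} (hXY : Holds σ (rEq F X (RName.ofSet Y)))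
    (hY : ∃ d, ∀ m, app.{u} F σ d m = chi Y m) : Holds σ (rDecidable F X) := by
  classical
  obtain ⟨e, he⟩ := hXY
  obtain ⟨d, hd⟩ := hY
  rw [rEq_iff] at he
  -- The realizer of `X = Y̌` may diverge off `Y`, so it is run only in the step of a recursion
  -- whose length is the value of the characteristic function.
  refine holds_rDecidable_of_rAllNat ⟨compIdx
    (precIdx (constIdx (Nat.pair 1 0)) (pairIdx (constIdx 0) (compIdx e.unpair.2 2)))
    (pairIdx idIdx d), fun τ hτ m => ?_⟩
  by_cases hm : m ∈ Y
  · have hdm : 1 ∈ app.{u} F τ d m := mem_app_mono hτ (by simp [hd, chi, hm])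
    obtain ⟨v, hv, hv'⟩ := (he τ hτ).2 ⟨⟨m, hm⟩⟩ m rfl
    refine ⟨Nat.pair 0 v, comp_mem_eval (pair_mem_eval id_mem_eval hdm)
      (prec_one_mem_eval (const_mem_eval _) (pair_mem_eval (const_mem_eval 0)
        (comp_mem_eval left_mem_eval (by simpa using! hv)))), Or.inl ?_⟩
    simpa using! hv'
  · have hdm : 0 ∈ app.{u} F τ d m := mem_app_mono hτ (by simp [hd, chi, hm])
    refine ⟨Nat.pair 1 0, comp_mem_eval (pair_mem_eval id_mem_eval hdm)
      (prec_zero_mem_eval (const_mem_eval _)), Or.inr ⟨by simp, fun ρ hρ g hg => ?_⟩⟩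
    obtain ⟨i, hi, hmi⟩ := hg
    obtain ⟨v, -, hv⟩ := (he ρ (hτ.trans hρ)).1 i _ hi
    obtain ⟨c, hc⟩ := rMem_congr_left (rEq_symm hmi) hv
    exact absurd (mem_of_rMem_num_ofSet hc) hm

/-- A decidable set of naturals agrees with the set `Y` of those `m` that the realizer of
decidability accepts at `σ`. -/
theorem exists_rEq_ofSet_of_rDecidable (hX : Holds σ (rSubset F X RName.omega))
    (hdec : Holds σ (rDecidable F X)) :
    ∃ Y : Set ℕ, Holds σ (rEq F X (RName.ofSet Y)) ∧ ∃ d, ∀ m, app.{u} F σ d m = chi Y m := by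
  classical
  obtain ⟨a, ha⟩ := hX
  obtain ⟨b, hb⟩ := hdec
  obtain ⟨i, hi⟩ := exists_rEq_refl.{u}
  have hdecide : ∀ m, ∃ v ∈ app.{u} F σ b (Nat.pair m i),
      rOr (rMem F (RName.num m) X) (rNot.{u} F (rMem F (RName.num m) X)) σ v := fun m =>
    hb σ (List.prefix_refl σ) (RName.num m) σ (List.prefix_refl σ) (Nat.pair m i)
      (rMem_omega.2 (by simpa using hi F _ σ))
  choose v hv hv' using hdecide
  have hrun : ∀ τ, σ <+: τ → ∀ m, v m ∈ app.{u} F τ (compIdx b (pairIdx idIdx (constIdx i))) m :=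
    fun τ hτ m => comp_mem_eval (pair_mem_eval id_mem_eval (const_mem_eval i))
      (mem_app_mono hτ (hv m))
  -- The decision taken at `σ` is not reversed at a later node.
  have hmem : ∀ τ, σ <+: τ → ∀ m c, rMem F (RName.num m) X τ c → (v m).unpair.1 = 0 := by
    intro τ hτ m c hc
    rcases hv' m with h | ⟨-, hneg⟩
    · exact h.1
    · obtain ⟨w, -, hw⟩ := hneg τ hτ c hc
      exact hw.elim
  refine ⟨{m | (v m).unpair.1 = 0}, ⟨Nat.pair (compIdx a (pairIdx idIdx (constIdx i)))
    (compIdx 3 (compIdx b (pairIdx idIdx (constIdx i)))), ?_⟩, ?_⟩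
  · rw [rEq_iff]
    intro τ hτ
    simp only [Nat.unpair_pair]
    constructor
    · intro j f hj
      have hjX : rMem F (X.elt j) X τ (Nat.pair f i) :=
        ⟨j, by simpa using hj, by simpa using hi F _ τ⟩
      obtain ⟨w, hw, hw'⟩ := ha τ hτ (X.elt j) τ (List.prefix_refl τ) _ hjX
      refine ⟨w, comp_mem_eval (pair_mem_eval id_mem_eval (const_mem_eval i)) hw, ?_⟩
      rw [rMem_omega] at hw'
      obtain ⟨c, hc⟩ := rMem_congr_left hw' hjX
      exact rMem_ofSet.2 ⟨hmem τ hτ _ c hc, hw'⟩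
    · rintro ⟨⟨m, hm⟩⟩ f hf
      have hf' : f = m := hf
      subst hf'
      refine ⟨_, comp_mem_eval (hrun τ hτ f) right_mem_eval, rMem_mono hτ ?_⟩
      rcases hv' f with h | h
      · exact h.2
      · exact absurd hm h.1
  · obtain ⟨k, hk⟩ := exists_index_of_primrec (f := fun n => if n.unpair.1 = 0 then 1 else 0)
      (Primrec.ite (Primrec.eq.comp primrec_unpair_fst (Primrec.const 0)) (Primrec.const 1)
        (Primrec.const 0))
    refine ⟨compIdx k (compIdx b (pairIdx idIdx (constIdx i))), fun m =>
      Part.eq_some_iff.2 (comp_mem_eval (hrun σ (List.prefix_refl σ) m) ?_)⟩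
    convert hk _ (v m)
    rfl

theorem holds_rSubset_omega (Y : Set ℕ) :
    Holds σ (rSubset F (RName.ofSet.{u} Y) RName.omega) :=
  ⟨idIdx, fun _ _ _ _ _ f hf => ⟨f, id_mem_eval, rMem_omega.2 (rMem_ofSet.1 hf).2⟩⟩

theorem subset_of_rEq_ofSet {Y Z : Set ℕ} {e : ℕ}
    (h : rEq F (RName.ofSet.{u} Y) (RName.ofSet Z) σ e) : Y ⊆ Z := by
  intro m hm
  rw [rEq_iff] at h
  obtain ⟨v, -, hv⟩ := (h σ (List.prefix_refl σ)).1 ⟨⟨m, hm⟩⟩ m rfl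
  exact mem_of_rMem_num_ofSet hv

theorem ofSet_inj {Y Z : Set ℕ}
    (h : Holds σ (rEq F (RName.ofSet.{u} Y) (RName.ofSet Z))) : Y = Z := by
  obtain ⟨e, he⟩ := h
  exact (subset_of_rEq_ofSet he).antisymm (subset_of_rEq_ofSet (rEq_symm he))

/-- A branch is decidable: from the length of a node, the realizer of "`X` is a branch" computes the
only element of `X` of that length, which is then compared with the node. -/
theorem holds_rDecidable_of_rIsBranch (hX : Holds σ (rIsBranch F X)) :
    Holds σ (rDecidable F X) := by
  obtain ⟨e, ⟨hsub, -, hex⟩⟩ := hX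
  obtain ⟨i, hi⟩ := exists_rEq_refl.{u}
  have hlen : Primrec fun m : ℕ => (((Encodable.decode m : Option (List Bool)).getD []).length) :=
    Primrec.list_length.comp (Primrec.option_getD.comp Primrec.decode (Primrec.const []))
  obtain ⟨l, hl⟩ := exists_index_of_primrec hlen
  obtain ⟨k, hk⟩ := exists_index_of_primrec (f := fun p =>
      if p.unpair.2.unpair.1 = p.unpair.1 then
        Nat.pair 0 p.unpair.2.unpair.2.unpair.1.unpair.2
      else Nat.pair 1 0) <| by
    exact Primrec.ite
      (Primrec.eq.comp (primrec_unpair_fst.comp primrec_unpair_snd) primrec_unpair_fst)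
      (Primrec₂.natPair.comp (Primrec.const 0) (primrec_unpair_snd.comp
        (primrec_unpair_fst.comp (primrec_unpair_snd.comp primrec_unpair_snd))))
      (Primrec.const _)
  refine holds_rDecidable_of_rAllNat
    ⟨compIdx k (pairIdx idIdx (compIdx e.unpair.2.unpair.2 l)), fun τ hτ m => ?_⟩
  obtain ⟨v, hv, ⟨-, hvX⟩, huniq⟩ := hex τ hτ _
  refine ⟨_, comp_mem_eval (pair_mem_eval id_mem_eval (comp_mem_eval (hl _ m) hv)) (hk _ _), ?_⟩
  simp only [Nat.unpair_pair]
  split_ifs with hm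
  · exact Or.inl ⟨by simp, by simpa [← hm] using hvX⟩
  · refine Or.inr ⟨by simp, fun ρ hρ c hc => absurd ?_ hm⟩
    obtain ⟨w, -, hw⟩ := hsub ρ (hτ.trans hρ) _ ρ (List.prefix_refl ρ) c hc
    obtain ⟨b, rfl⟩ := mem_of_rMem_num_ofSet hw
    obtain ⟨u, -, hu⟩ := huniq ρ hρ (Encodable.encode b)
    obtain ⟨w', -, hw'⟩ := hu ρ (List.prefix_refl ρ) (Nat.pair 0 c)
      ⟨⟨b, rfl, by simp⟩, by simpa using hc⟩
    exact (rEq_num_inj (hi F _ ρ) hw').symm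

end

end KripkeReal

theorem mainTheorem5
    (r : ℕ → Set ℕ)
    (hr : ∀ m n, m < n → KripkeReal.ComputableFrom (r m) (r n) ∧
      ¬ KripkeReal.ComputableFrom (r n) (r m))
    (F : ℕ → ℕ → Set ℕ)
    (hF : ∀ n, Set.range (F n) = {A : Set ℕ | (symmDiff A (r n)).Finite})
    (σ : KripkeReal.Node) :
    (∀ X : Set ℕ,
      KripkeReal.Holds σ (KripkeReal.rDecidable F (KripkeReal.RName.ofSet.{u} X)) ↔
        KripkeReal.ComputableFrom X (KripkeReal.prevReal r σ.length)) ∧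
    (∀ X : KripkeReal.RName.{u},
      KripkeReal.Holds σ (KripkeReal.rSubset F X KripkeReal.RName.omega) →
        (KripkeReal.Holds σ (KripkeReal.rDecidable F X) ↔
          ∃ Y : Set ℕ, KripkeReal.Holds σ (KripkeReal.rEq F X (KripkeReal.RName.ofSet Y)) ∧
            KripkeReal.ComputableFrom Y (KripkeReal.prevReal r σ.length))) ∧
    (∀ X : KripkeReal.RName.{u},
      KripkeReal.Holds σ (KripkeReal.rIsBranch F X) →
        KripkeReal.Holds σ (KripkeReal.rDecidable F X)) := by
  have hcomp := KripkeReal.computableFrom_prevReal_iff.{u} hF (fun m n h => (hr m n h).1) σ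
  refine ⟨fun X => ?_, fun X hX => ?_, fun X => KripkeReal.holds_rDecidable_of_rIsBranch⟩
  · rw [hcomp]
    constructor
    · intro h
      obtain ⟨Y, hXY, hY⟩ :=
        KripkeReal.exists_rEq_ofSet_of_rDecidable (KripkeReal.holds_rSubset_omega X) h
      rwa [KripkeReal.ofSet_inj hXY]
    · obtain ⟨i, hi⟩ := KripkeReal.exists_rEq_refl.{u}
      exact KripkeReal.holds_rDecidable_of_rEq_ofSet ⟨i, hi F _ σ⟩
  · simp only [hcomp]
    exact ⟨KripkeReal.exists_rEq_ofSet_of_rDecidable hX,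
      fun ⟨Y, hXY, hY⟩ => KripkeReal.holds_rDecidable_of_rEq_ofSet hXY hY⟩
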